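/- **Conventions.** Fix a category $\mathbb{G}$. An *overcategory* is a functor $A:\mathbb{E}\to\mathbb{G}$; overfunctors, overadjunctions and overmonads are the 1-cells, adjunctions and monads of the 2-category $\mathbb{C}\mathrm{AT}/\mathbb{G}$ (functors commute strictly with the functors to $\mathbb{G}$; 2-cells, in particular units and counits, lie over identities). For an object $B$ of $\mathbb{G}$, $\mathbb{E}_B$ is the category of objects over $B$ and arrows over $1_B$; for an arrow $b:B\to B'$, $\mathbb{E}_b$ is the category whose objects are the arrows of $\mathbb{E}$ over $b$ and whose morphisms are the commutative squares between them whose two sides lie over $1_B$ and $1_{B'}$. A *monoidal overcategory* $\mathcal{E}=(\mathbb{E},A,\otimes,I,u_l,u_r,aso)$ consists of an overfunctor $\otimes:\mathbb{E}\times_{\mathbb{G}}\mathbb{E}\to\mathbb{E}$, a section $I:\mathbb{G}\to\mathbb{E}$ of $A$, and natural isomorphisms $u_l,u_r,aso$ over $\mathbb{G}$ satisfying the axioms of a monoidal category; each fiber $\mathbb{E}_B$ is then a monoidal category. A monoidal category $\mathbb{V}$ is *liberal* if it has coequalizers and colimits of sequences (indexed by the ordered set $\mathbb{N}$), if $(-)\otimes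 X$ and $X\otimes(-)$ preserve colimits of sequences and $(-)\otimes X$ preserves coequalizers, for every object $X$. $\mathcal{E}$ is *liberal* if every fiber $\mathbb{E}_B$ is a liberal monoidal category and every inclusion $\mathbb{E}_B\hookrightarrow\mathbb{E}$ preserves coequalizers and colimits of sequences. An *overmonoid* is $(C,m,e;C_0)$ with $(C,m,e)$ a monoid in $\mathbb{E}_{C_0}$; a morphism $(C,m,e;C_0)\to(C',m',e';C_0')$ is a pair $(f,f_0)$ with $f_0:C_0\to C_0'$ in $\mathbb{G}$ and $f:C\to C'$ over $f_0$ such that $fm=m'(f\otimes f)$ and $fe=e'I(f_0)$. Overmonoids form an overcategory $(/\mathbb{M}on(\mathbb{E},A),A)$, with arity functor $(C,m,e;C_0)\mapsto C_0$, $(f,f_0)\mapsto f_0$. **Theorem.** Let $\mathcal{E}$ be a liberal monoidal overcategory such that $I(B)$ is initial in $\mathbb{E}_B$ for every object $B$ of $\mathbb{G}$ and $I(b)$ is initial in $\mathbb{E}_b$ for every arrow $b$ of $\mathbb{G}$. Then the forgetful overfunctor $$U:(/\mathbb{M}on(\mathbb{E},A),A)\longrightarrow(\mathbb{E},A),\qquad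 (C,m,e;C_0)\mapsto C,$$ has a left overadjoint $M\dashv U$, and $U$ is overmonadic: for every left overadjoint $M$ of $U$, with induced overmonad $T=UM$, the comparison overfunctor from $(/\mathbb{M}on(\mathbb{E},A),A)$ to the overcategory $(\mathbb{E}^{T},A)$ of $T$-algebras is an isomorphism in $\mathbb{C}\mathrm{AT}/\mathbb{G}$. -/

import Mathlib

open CategoryTheory CategoryTheory.Limits

universe v₁ v₂ v₃ v₄ u₁ u₂ u₃ u₄

namespace Overcat

/-! An overcategory over `G` is a category `E` with a functor `A : E ⥤ G` (the arity functor).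
Its fiber over an object `B` is `A.Fiber B`, and `A.IsHomLift b f` says that the arrow `f`
of `E` lies over the arrow `b` of `G`. -/

section

variable {E : Type u₁} [Category.{v₁} E] {G : Type u₂} [Category.{v₂} G]

/-! ### The kernel pair `E ×_G E` -/

/-- Objects of the kernel pair of `A`: pairs of objects of `E` with the same arity. -/
structure KernelPair (A : E ⥤ G) where
  fst : E
  snd : E
  w : A.obj fst = A.obj snd

namespace KernelPair

variable {A : E ⥤ G}

/-- Arrows of the kernel pair: pairs of arrows of `E` lying over the same arrow of `G`. -/
@[ext]
structure Hom (P Q : KernelPair A) where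
  fst : P.fst ⟶ Q.fst
  snd : P.snd ⟶ Q.snd
  w : A.IsHomLift (A.map fst) snd

instance : Category (KernelPair A) where
  Hom := Hom
  id P := ⟨𝟙 _, 𝟙 _, by rw [A.map_id]; exact IsHomLift.id P.w.symm⟩
  comp f g := ⟨f.fst ≫ g.fst, f.snd ≫ g.snd, by
    have := f.w
    have := g.w
    rw [A.map_comp]
    infer_instance⟩

/-- The first projection `E ×_G E ⥤ E`. -/
def proj (A : E ⥤ G) : KernelPair A ⥤ E where
  obj P := P.fst
  map f := Hom.fst f

/-- The structure of overcategory on `E ×_G E`. -/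
def arity (A : E ⥤ G) : KernelPair A ⥤ G := proj A ⋙ A

/-- Two objects of the same fiber form an object of the kernel pair. -/
def mk' {B : G} (X Y : A.Fiber B) : KernelPair A := ⟨X.1, Y.1, X.2.trans Y.2.symm⟩

lemma isHomLift_snd {B B' : G} (b : B ⟶ B') {X X' Y Y' : E} (f : X ⟶ X') (g : Y ⟶ Y')
    [A.IsHomLift b f] [hg : A.IsHomLift b g] : A.IsHomLift (A.map f) g := by
  have h := IsHomLift.fac' A b f
  rw [h]
  infer_instance

/-- Two arrows over the same `b` form an arrow of the kernel pair. -/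
def homMk' {B B' : G} (b : B ⟶ B') {X Y : A.Fiber B} {X' Y' : A.Fiber B'}
    (f : X.1 ⟶ X'.1) (g : Y.1 ⟶ Y'.1) [A.IsHomLift b f] [A.IsHomLift b g] :
    mk' X Y ⟶ mk' X' Y' :=
  Hom.mk (P := mk' X Y) (Q := mk' X' Y') f g (isHomLift_snd b f g)

end KernelPair

/-! ### Monoidal overcategories -/

/-- The functors underlying a monoidal overcategory: a tensor product `E ×_G E ⥤ E` over `G`
and a section `G ⥤ E` of the arity functor. -/
class OverTensor (A : E ⥤ G) where
  tensor : KernelPair A ⥤ E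
  tensor_over : tensor ⋙ A = KernelPair.arity A
  unit : G ⥤ E
  unit_over : unit ⋙ A = 𝟭 G

section

variable {A : E ⥤ G}

lemma isHomLift_of_comp_eq {C : Type u₃} [Category.{v₃} C] {F : C ⥤ E} {K : C ⥤ G}
    (h : F ⋙ A = K) {X Y : C} (f : X ⟶ Y) : A.IsHomLift (K.map f) (F.map f) := by
  subst h
  exact IsHomLift.map A (F.map f)

variable [OverTensor A]

/-- The tensor product of two objects of the same fiber, as an object of this fiber. -/
def tensorObj {B : G} (X Y : A.Fiber B) : A.Fiber B :=
  ⟨(OverTensor.tensor (A := A)).obj (KernelPair.mk' X Y),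
    (Functor.congr_obj (OverTensor.tensor_over (A := A)) _).trans X.2⟩

/-- The tensor product `f ⊗_b g` of two arrows lying over the same arrow `b`. -/
def tensorHom {B B' : G} (b : B ⟶ B') {X Y : A.Fiber B} {X' Y' : A.Fiber B'}
    (f : X.1 ⟶ X'.1) (g : Y.1 ⟶ Y'.1) [A.IsHomLift b f] [A.IsHomLift b g] :
    (tensorObj X Y).1 ⟶ (tensorObj X' Y').1 :=
  (OverTensor.tensor (A := A)).map (KernelPair.homMk' b f g)

instance tensorHom_isHomLift {B B' : G} (b : B ⟶ B') {X Y : A.Fiber B} {X' Y' : A.Fiber B'}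
    (f : X.1 ⟶ X'.1) (g : Y.1 ⟶ Y'.1) [A.IsHomLift b f] [A.IsHomLift b g] :
    A.IsHomLift b (tensorHom b f g) := by
  have h := isHomLift_of_comp_eq (OverTensor.tensor_over (A := A)) (KernelPair.homMk' b f g)
  have e : (KernelPair.arity A).map (KernelPair.homMk' b f g) = A.map f := rfl
  rw [e, IsHomLift.fac' A b f] at h
  have h' : A.IsHomLift (b ≫ eqToHom (IsHomLift.codomain_eq A b f).symm) (tensorHom b f g) :=
    (IsHomLift.lift_eqToHom_comp_iff A _ _ _).1 h
  exact (IsHomLift.lift_comp_eqToHom_iff A _ _ _).1 h'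

/-- The value `I(B)` of the unit, as an object of the fiber over `B`. -/
def unitObj (A : E ⥤ G) [OverTensor A] (B : G) : A.Fiber B :=
  ⟨(OverTensor.unit (A := A)).obj B, Functor.congr_obj (OverTensor.unit_over (A := A)) B⟩

/-- The value `I(b)` of the unit at an arrow `b`. -/
def unitMap (A : E ⥤ G) [OverTensor A] {B B' : G} (b : B ⟶ B') :
    (unitObj A B).1 ⟶ (unitObj A B').1 :=
  (OverTensor.unit (A := A)).map b

instance unitMap_isHomLift {B B' : G} (b : B ⟶ B') : A.IsHomLift b (unitMap A b) :=
  isHomLift_of_comp_eq (OverTensor.unit_over (A := A)) b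

instance fiberHom_isHomLift {B : G} {X Y : A.Fiber B} (f : X ⟶ Y) :
    A.IsHomLift (𝟙 B) f.1 := f.2

lemma tensorHom_id {B : G} (X Y : A.Fiber B) :
    haveI := IsHomLift.id X.2
    haveI := IsHomLift.id Y.2
    tensorHom (𝟙 B) (𝟙 X.1) (𝟙 Y.1) = 𝟙 (tensorObj X Y).1 :=
  (OverTensor.tensor (A := A)).map_id _

lemma tensorHom_comp {B B' B'' : G} (b : B ⟶ B') (b' : B' ⟶ B'') {X Y : A.Fiber B}
    {X' Y' : A.Fiber B'} {X'' Y'' : A.Fiber B''} (f : X.1 ⟶ X'.1) (g : Y.1 ⟶ Y'.1)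
    (f' : X'.1 ⟶ X''.1) (g' : Y'.1 ⟶ Y''.1) [A.IsHomLift b f] [A.IsHomLift b g]
    [A.IsHomLift b' f'] [A.IsHomLift b' g'] :
    tensorHom b f g ≫ tensorHom b' f' g' = tensorHom (b ≫ b') (f ≫ f') (g ≫ g') :=
  ((OverTensor.tensor (A := A)).map_comp _ _).symm

lemma tensorHom_congr {B B' : G} {b b' : B ⟶ B'} (e : b = b') {X Y : A.Fiber B}
    {X' Y' : A.Fiber B'} (f : X.1 ⟶ X'.1) (g : Y.1 ⟶ Y'.1) [A.IsHomLift b f]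
    [A.IsHomLift b g] [A.IsHomLift b' f] [A.IsHomLift b' g] :
    tensorHom b f g = tensorHom b' f g := by
  subst e
  rfl

lemma unitMap_id (B : G) : unitMap A (𝟙 B) = 𝟙 (unitObj A B).1 :=
  (OverTensor.unit (A := A)).map_id B

lemma unitMap_comp {B B' B'' : G} (b : B ⟶ B') (b' : B' ⟶ B'') :
    unitMap A (b ≫ b') = unitMap A b ≫ unitMap A b' :=
  (OverTensor.unit (A := A)).map_comp b b'

/-- The tensor product of two arrows of the same fiber, as an arrow of this fiber. -/
def fiberTensorHom {B : G} {X Y X' Y' : A.Fiber B} (f : X ⟶ X') (g : Y ⟶ Y') :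
    tensorObj X Y ⟶ tensorObj X' Y' :=
  ⟨tensorHom (𝟙 B) f.1 g.1, inferInstance⟩

end

/-- A monoidal overcategory. The associativity and unit isomorphisms are 2-cells over `G`, so
their components are isomorphisms of the fibers; they are natural with respect to all arrows
of `E`, and satisfy the pentagon and triangle axioms. -/
class MonoidalOvercategory (A : E ⥤ G) extends OverTensor A where
  associator {B : G} (X Y Z : A.Fiber B) :
    tensorObj (tensorObj X Y) Z ≅ tensorObj X (tensorObj Y Z)
  leftUnitor {B : G} (X : A.Fiber B) : tensorObj (unitObj A B) X ≅ X
  rightUnitor {B : G} (X : A.Fiber B) : tensorObj X (unitObj A B) ≅ X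
  associator_naturality {B B' : G} (b : B ⟶ B') {X Y Z : A.Fiber B} {X' Y' Z' : A.Fiber B'}
    (f : X.1 ⟶ X'.1) (g : Y.1 ⟶ Y'.1) (h : Z.1 ⟶ Z'.1)
    [A.IsHomLift b f] [A.IsHomLift b g] [A.IsHomLift b h] :
    tensorHom b (tensorHom b f g) h ≫ (associator X' Y' Z').hom.1 =
      (associator X Y Z).hom.1 ≫ tensorHom b f (tensorHom b g h)
  leftUnitor_naturality {B B' : G} (b : B ⟶ B') {X : A.Fiber B} {X' : A.Fiber B'}
    (f : X.1 ⟶ X'.1) [A.IsHomLift b f] :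
    tensorHom b (unitMap A b) f ≫ (leftUnitor X').hom.1 = (leftUnitor X).hom.1 ≫ f
  rightUnitor_naturality {B B' : G} (b : B ⟶ B') {X : A.Fiber B} {X' : A.Fiber B'}
    (f : X.1 ⟶ X'.1) [A.IsHomLift b f] :
    tensorHom b f (unitMap A b) ≫ (rightUnitor X').hom.1 = (rightUnitor X).hom.1 ≫ f
  pentagon {B : G} (W X Y Z : A.Fiber B) :
    fiberTensorHom (associator W X Y).hom (𝟙 Z) ≫ (associator W (tensorObj X Y) Z).hom ≫
        fiberTensorHom (𝟙 W) (associator X Y Z).hom =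
      (associator (tensorObj W X) Y Z).hom ≫ (associator W X (tensorObj Y Z)).hom
  triangle {B : G} (X Y : A.Fiber B) :
    (associator X (unitObj A B) Y).hom ≫ fiberTensorHom (𝟙 X) (leftUnitor Y).hom =
      fiberTensorHom (rightUnitor X).hom (𝟙 Y)

instance fiberMonoidalStruct (A : E ⥤ G) [MonoidalOvercategory A] (B : G) :
    MonoidalCategoryStruct (A.Fiber B) where
  tensorObj := tensorObj
  tensorHom := fiberTensorHom
  whiskerLeft X _ _ f := fiberTensorHom (𝟙 X) f
  whiskerRight f Y := fiberTensorHom f (𝟙 Y)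
  tensorUnit := unitObj A B
  associator := MonoidalOvercategory.associator
  leftUnitor := MonoidalOvercategory.leftUnitor
  rightUnitor := MonoidalOvercategory.rightUnitor

/-- Each fiber of a monoidal overcategory is a monoidal category. -/
instance fiberMonoidal (A : E ⥤ G) [MonoidalOvercategory A] (B : G) :
    MonoidalCategory (A.Fiber B) :=
  MonoidalCategory.ofTensorHom
    (id_tensorHom_id := fun X Y => Subtype.ext (tensorHom_id X Y))
    (id_tensorHom := fun _ _ _ _ => rfl)
    (tensorHom_id := fun _ _ => rfl)
    (tensorHom_comp_tensorHom := fun f₁ f₂ g₁ g₂ => Subtype.ext (by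
      refine (tensorHom_comp (𝟙 B) (𝟙 B) f₁.1 f₂.1 g₁.1 g₂.1).trans ?_
      exact tensorHom_congr (Category.comp_id (𝟙 B)) _ _))
    (associator_naturality := fun f₁ f₂ f₃ =>
      Subtype.ext (MonoidalOvercategory.associator_naturality (𝟙 B) f₁.1 f₂.1 f₃.1))
    (leftUnitor_naturality := fun f => Subtype.ext (by
      refine Eq.trans ?_ (MonoidalOvercategory.leftUnitor_naturality (𝟙 B) f.1)
      simp only [unitMap_id]
      rfl))
    (rightUnitor_naturality := fun f => Subtype.ext (by
      refine Eq.trans ?_ (MonoidalOvercategory.rightUnitor_naturality (𝟙 B) f.1)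
      simp only [unitMap_id]
      rfl))
    (pentagon := MonoidalOvercategory.pentagon)
    (triangle := MonoidalOvercategory.triangle)

/-! ### Overmonoids -/

/-- An overmonoid `(C, m, e; C₀)`: a monoid in the fiber over an object `C₀` of `G`. -/
structure OverMon (A : E ⥤ G) [MonoidalOvercategory A] where
  base : G
  mon : Mon (A.Fiber base)

namespace OverMon

variable {A : E ⥤ G} [MonoidalOvercategory A]

/-- The underlying object of `E`. -/
abbrev carrier (C : OverMon A) : E := C.mon.X.1

/-- The multiplication, as an arrow of `E`. -/
def mul (C : OverMon A) : (tensorObj C.mon.X C.mon.X).1 ⟶ C.carrier :=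
  (MonObj.mul (X := C.mon.X)).1

/-- The unit, as an arrow of `E`. -/
def one (C : OverMon A) : (unitObj A C.base).1 ⟶ C.carrier :=
  (MonObj.one (X := C.mon.X)).1

/-- A morphism of overmonoids: an arrow `f` over `f₀` with `f m = m' (f ⊗ f)` and
`f e = e' I(f₀)`. -/
@[ext]
structure Hom (C D : OverMon A) where
  base : C.base ⟶ D.base
  hom : C.carrier ⟶ D.carrier
  isHomLift : A.IsHomLift base hom
  map_mul : C.mul ≫ hom = tensorHom base (X := C.mon.X) (Y := C.mon.X) (X' := D.mon.X)
    (Y' := D.mon.X) hom hom ≫ D.mul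
  map_one : C.one ≫ hom = unitMap A base ≫ D.one

instance : Category (OverMon A) where
  Hom := Hom
  id C :=
    { base := 𝟙 _
      hom := 𝟙 _
      isHomLift := IsHomLift.id C.mon.X.2
      map_mul := by
        refine (Category.comp_id _).trans ?_
        refine (Category.id_comp _).symm.trans (congrArg (· ≫ C.mul) ?_)
        exact (tensorHom_id C.mon.X C.mon.X).symm
      map_one := by
        rw [unitMap_id]
        exact (Category.comp_id _).trans (Category.id_comp _).symm }
  comp {C D K} f g :=
    { base := f.base ≫ g.base
      hom := f.hom ≫ g.hom
      isHomLift := by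
        have := f.isHomLift
        have := g.isHomLift
        infer_instance
      map_mul := by
        have := f.isHomLift
        have := g.isHomLift
        have h := tensorHom_comp f.base g.base (X := C.mon.X) (Y := C.mon.X) (X' := D.mon.X)
          (Y' := D.mon.X) (X'' := K.mon.X) (Y'' := K.mon.X) f.hom f.hom g.hom g.hom
        rw [← Category.assoc, f.map_mul, Category.assoc, g.map_mul, ← Category.assoc]
        exact congrArg (· ≫ K.mul) h
      map_one := by
        rw [← Category.assoc, f.map_one, Category.assoc, g.map_one, ← Category.assoc,
          unitMap_comp] }

variable (A)

/-- The arity functor of the overcategory of overmonoids. -/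
def arity : OverMon A ⥤ G where
  obj C := C.base
  map f := Hom.base f

/-- The forgetful functor from overmonoids to `E`. -/
def forget : OverMon A ⥤ E where
  obj C := C.carrier
  map f := Hom.hom f

/-- The forgetful functor is an overfunctor. -/
lemma forget_over : forget A ⋙ A = arity A := by
  have h (X : OverMon A) : (forget A ⋙ A).obj X = (arity A).obj X := Subtype.property X.mon.X
  refine CategoryTheory.Functor.ext h (fun X Y f => ?_)
  have := Hom.isHomLift f
  exact IsHomLift.fac' A (Hom.base f) (Hom.hom f)

end OverMon

/-! ### Liberal monoidal (over)categories -/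

/-- A monoidal category is liberal if it has colimits of sequences and coequalizers, if
`- ⊗ X` and `X ⊗ -` preserve colimits of sequences, and if `- ⊗ X` preserves coequalizers. -/
structure IsLiberalMonoidal (V : Type u₃) [Category.{v₃} V] [MonoidalCategory V] : Prop where
  hasSequentialColimits : HasColimitsOfShape ℕ V
  hasCoequalizers : HasCoequalizers V
  tensorRight_sequential (X : V) :
    PreservesColimitsOfShape ℕ (MonoidalCategory.tensorRight X)
  tensorLeft_sequential (X : V) :
    PreservesColimitsOfShape ℕ (MonoidalCategory.tensorLeft X)
  tensorRight_coequalizers (X : V) :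
    PreservesColimitsOfShape WalkingParallelPair (MonoidalCategory.tensorRight X)

/-- A monoidal overcategory is liberal if its fibers are liberal monoidal categories and the
inclusions of the fibers preserve coequalizers and colimits of sequences. -/
structure IsLiberal (A : E ⥤ G) [MonoidalOvercategory A] : Prop where
  fiber (B : G) : IsLiberalMonoidal (A.Fiber B)
  inclusion_coequalizers (B : G) :
    PreservesColimitsOfShape WalkingParallelPair
      (Functor.Fiber.fiberInclusion : A.Fiber B ⥤ E)
  inclusion_sequential (B : G) :
    PreservesColimitsOfShape ℕ (Functor.Fiber.fiberInclusion : A.Fiber B ⥤ E)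

/-- The fiber `E_b` over an arrow `b` of `G`: its objects are the arrows of `E` over `b`, and
its morphisms are the commutative squares whose two sides lie over identities. -/
abbrev ArrowFiber (A : E ⥤ G) {B B' : G} (b : B ⟶ B') :=
  A.mapArrow.Fiber (Arrow.mk b)

/-- The arrow `I(b)`, as an object of the fiber `E_b`. -/
def unitArrow (A : E ⥤ G) [OverTensor A] {B B' : G} (b : B ⟶ B') : ArrowFiber A b :=
  ⟨Arrow.mk ((OverTensor.unit (A := A)).map b),
    Functor.congr_obj (congrArg Functor.mapArrow (OverTensor.unit_over (A := A))) (Arrow.mk b)⟩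

end

/-! ### Overadjunctions and overmonadicity -/

section

variable {G : Type u₂} [Category.{v₂} G] {C : Type u₃} [Category.{v₃} C]
  {D : Type u₄} [Category.{v₄} D]

/-- An overadjunction `F ⊣ U` between overcategories `(C, A)` and `(D, A')` over `G`, that is,
an adjunction in the 2-category of categories over `G`: both functors are overfunctors, and the
unit and the counit lie over identities. -/
structure OverAdjunction (A : C ⥤ G) (A' : D ⥤ G) (F : C ⥤ D) (U : D ⥤ C) where
  left_over : F ⋙ A' = A
  right_over : U ⋙ A = A'
  adj : F ⊣ U
  unit_over (X : C) : A.IsHomLift (𝟙 (A.obj X)) (adj.unit.app X)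
  counit_over (Y : D) : A'.IsHomLift (𝟙 (A'.obj Y)) (adj.counit.app Y)

/-- `K` is an isomorphism in the category of categories over `G`. -/
def IsOverIso (A : C ⥤ G) (A' : D ⥤ G) (K : C ⥤ D) : Prop :=
  K ⋙ A' = A ∧ ∃ L : D ⥤ C, L ⋙ A = A' ∧ K ⋙ L = 𝟭 C ∧ L ⋙ K = 𝟭 D

/-- The overfunctor `U : (D, A') ⥤ (C, A)` is overmonadic if it has a left overadjoint and,
for every left overadjoint, the comparison functor from `D` to the overcategory of algebras of
the induced overmonad is an isomorphism over `G`. -/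
def IsOvermonadic (A : C ⥤ G) (A' : D ⥤ G) (U : D ⥤ C) : Prop :=
  (∃ F : C ⥤ D, Nonempty (OverAdjunction A A' F U)) ∧
    ∀ (F : C ⥤ D) (h : OverAdjunction A A' F U),
      IsOverIso A' (h.adj.toMonad.forget ⋙ A) (Monad.comparison h.adj)

end

end Overcat

namespace Overcat

/-! ### Free algebras of pointed endofunctors -/

section FreeAlgebra

variable {V : Type u₁} [Category.{v₁} V]

/-! Initiality of I(B) gives every object over B a unique point, and initiality of I(b) makes every
arrow over b preserve these points (`Lift.pre_point`). A left overadjoint of U must therefore send X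
to a free monoid on the pointed object X, universal not only inside the fiber of X but also for
arrows over any b into monoids of other fibers.

This monoid is the free algebra, on the unit object, of the pointed endofunctor T = X ⊗ -. It is the
colimit of a sequence with Y₀ = Y, Y₁ = T Y₀ and Yₙ₊₂ a coequalizer of two arrows T Yₙ ⇉ T Yₙ₊₁; T
preserves that colimit, so the partial actions T Yₙ → Yₙ₊₁ become an action
(`nonempty_freeAlgebra`). The universal property is proved against presheaves H that turn
coequalizers and colimits of sequences into limits and carry an action H(Z) → H(T Z), rather than
against algebras alone. Two kinds of H are used. The presheaves Hom(- ⊗ Y, W) qualify because - ⊗ Y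
preserves these colimits; they yield the multiplication and its laws without any closed structure.
The arrows over b into a monoid of another fiber qualify because the fiber inclusions preserve these
colimits; they yield the universal property across fibers (`FreeAlgebra.existsUnique_isMonHom`).

Overmonadicity needs no colimits. The structure map of a T-algebra (T now the overmonad) is a
coequalizer split by vertical arrows, and splittings survive tensoring. Hence the underlying object
carries exactly one monoid structure for which the structure map is a morphism
(`OverMon.existsUnique_monObj_of_split`), and this uniqueness makes the comparison strictly
invertible. -/

/-- A presheaf of types, given elementarily. -/
structure Sections (V : Type u₁) [Category.{v₁} V] where
  sec : V → Type v₁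
  res {Z Z' : V} (f : Z ⟶ Z') : sec Z' → sec Z
  res_id {Z : V} (s : sec Z) : res (𝟙 Z) s = s
  res_comp {Z Z' Z'' : V} (f : Z ⟶ Z') (g : Z' ⟶ Z'') (s : sec Z'') :
    res (f ≫ g) s = res f (res g s)

/-- A presheaf sends the colimits of shape `J` to limits. -/
def Sections.Glues (H : Sections V) (J : Type) [Category.{0} J] : Prop :=
  ∀ (F : J ⥤ V) (c : Cocone F) (_ : IsColimit c) (s : ∀ j, H.sec (F.obj j))
    (_ : ∀ (i j : J) (f : i ⟶ j), H.res (F.map f) (s j) = s i),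
    ∃! k : H.sec c.pt, ∀ j, H.res (c.ι.app j) k = s j

/-- An algebra of the pointed endofunctor `(T, τ)` in the category of those presheaves which send
coequalizers and colimits of sequences to limits. -/
structure PresheafAlgebra (T : V ⥤ V) (τ : 𝟭 V ⟶ T) extends Sections V where
  glue_sequential : toSections.Glues ℕ
  glue_coequalizers : toSections.Glues WalkingParallelPair
  act {Z : V} : sec Z → sec (T.obj Z)
  res_act {Z Z' : V} (f : Z ⟶ Z') (s : sec Z') : res (T.map f) (act s) = act (res f s)
  res_unit {Z : V} (s : sec Z) : res (τ.app Z) (act s) = s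

lemma Sections.existsUnique_of_coequalizer {H : Sections V} (hH : H.Glues WalkingParallelPair)
    {P Q : V} (f g : P ⟶ Q) [HasCoequalizer f g] (s : H.sec Q) (hs : H.res f s = H.res g s) :
    ∃! k : H.sec (coequalizer f g), H.res (coequalizer.π f g) k = s := by
  let t : ∀ j, H.sec ((parallelPair f g).obj j) := fun j => match j with
      | .zero => H.res f s
      | .one => s
  obtain ⟨k, hk, hu⟩ := hH (parallelPair f g) _ (colimit.isColimit (parallelPair f g)) t (by
      rintro i j (_ | _ | j)
      · rfl
      · exact hs.symm
      · exact (congrArg (H.res · (t _)) ((parallelPair f g).map_id _)).trans (H.res_id _))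
  refine ⟨k, hk .one, fun k' hk' => hu k' ?_⟩
  rintro (_ | _)
  · have := (colimit.w (parallelPair f g) WalkingParallelPairHom.left).symm
    refine (congrArg (H.res · k') this).trans ((H.res_comp _ _ _).trans ?_)
    exact congrArg (H.res f) hk'
  · exact hk'

/-- A compatible family of sections over the terms of a sequence. -/
lemma Sections.existsUnique_of_sequence {H : Sections V} (hH : H.Glues ℕ)
    {P : ℕ → V} (x : ∀ n, P n ⟶ P (n + 1)) (c : Cocone (Functor.ofSequence x))
    (hc : IsColimit c) (s : ∀ n, H.sec (P n)) (hs : ∀ n, H.res (x n) (s (n + 1)) = s n) :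
    ∃! k : H.sec c.pt, ∀ n, H.res (c.ι.app n) k = s n := by
  refine hH (Functor.ofSequence x) c hc s ?_
  -- Compatibility along successors extends to all arrows by induction on the distance `d`.
  have key (d : ℕ) : ∀ (i j : ℕ) (f : i ⟶ j), j = i + d →
      H.res ((Functor.ofSequence x).map f) (s j) = s i := by
    induction d with
    | zero =>
      rintro i j f rfl
      have : f = 𝟙 _ := Subsingleton.elim _ _
      rw [this, CategoryTheory.Functor.map_id]
      exact H.res_id _
    | succ d ih =>
      rintro i j f rfl
      have : f = homOfLE (Nat.le_add_right i d) ≫ homOfLE (Nat.le_succ (i + d)) :=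
        Subsingleton.elim _ _
      rw [this, Functor.map_comp]
      refine (H.res_comp _ _ _).trans (Eq.trans (congrArg _ ?_) (ih i (i + d) _ rfl))
      exact (congrArg (H.res · (s (i + d + 1)))
        (Functor.ofSequence_map_homOfLE_succ x (i + d))).trans (hs (i + d))
  intro i j f
  exact key (j - i) i j f (by have := leOfHom f; lia)

/-- A stage of the construction of a free algebra: a partially defined action. -/
structure PartialAction (T : V ⥤ V) where
  dom : V
  cod : V
  act : T.obj dom ⟶ cod

namespace PartialAction

variable {T : V ⥤ V} (τ : 𝟭 V ⟶ T) [HasCoequalizers V]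

/-- The transition morphism to the next stage. -/
def trans (S : PartialAction T) : S.dom ⟶ S.cod := τ.app S.dom ≫ S.act

/-- The next stage. -/
noncomputable def next (S : PartialAction T) : PartialAction T where
  dom := S.cod
  cod := coequalizer (T.map (S.trans τ)) (S.act ≫ τ.app S.cod)
  act := coequalizer.π _ _

/-- The stages of the construction of the free algebra on `Y`. -/
noncomputable def stage (Y : V) : ℕ → PartialAction T
  | 0 => ⟨Y, T.obj Y, 𝟙 _⟩
  | n + 1 => (stage Y n).next τ

/-- The transition morphisms between the stages. -/
noncomputable def step (Y : V) (n : ℕ) : (stage τ Y n).dom ⟶ (stage τ Y (n + 1)).dom :=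
  (stage τ Y n).trans τ

/-- The action on a stage, with values in the next one. -/
noncomputable def stageAct (Y : V) (n : ℕ) :
    T.obj (stage τ Y n).dom ⟶ (stage τ Y (n + 1)).dom :=
  (stage τ Y n).act

lemma unit_stageAct (Y : V) (n : ℕ) :
    τ.app (stage τ Y n).dom ≫ stageAct τ Y n = step τ Y n := rfl

/-- This is the relation imposed by the coequalizer in `next`; it makes the partial actions
compatible with the transitions. -/
lemma map_step_stageAct (Y : V) (n : ℕ) :
    T.map (step τ Y n) ≫ stageAct τ Y (n + 1) = stageAct τ Y n ≫ step τ Y (n + 1) :=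
  (coequalizer.condition _ _).trans (Category.assoc _ _ _)

/-- The sections on the stages, defined by recursion. -/
lemma exists_sections (R : PresheafAlgebra T τ) (Y : V) (g : R.sec Y) :
    ∃ s : ∀ n, R.sec (stage τ Y n).dom, s 0 = g ∧
      ∀ n, R.res (stageAct τ Y n) (s (n + 1)) = R.act (s n) := by
  -- The section on stage n + 2 depends on those on stages n and n + 1, so the recursion carries
  -- consecutive pairs.
  let Q (n : ℕ) := {p : R.sec (stage τ Y n).dom × R.sec (stage τ Y (n + 1)).dom //
    R.res (stageAct τ Y n) p.2 = R.act p.1}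
  have next (n : ℕ) (p : Q n) : ∃ q : Q (n + 1), q.1.1 = p.1.2 := by
    obtain ⟨⟨a, b⟩, hab⟩ := p
    dsimp only at hab
    have hb : R.res (step τ Y n) b = a := by
      rw [← unit_stageAct, R.res_comp, hab, R.res_unit]
    obtain ⟨k, hk, -⟩ := Sections.existsUnique_of_coequalizer R.glue_coequalizers
      (T.map (step τ Y n)) (stageAct τ Y n ≫ τ.app _) (R.act b) (by
        rw [R.res_act, hb]
        exact (hab.symm.trans (congrArg _ (R.res_unit b).symm)).trans (R.res_comp _ _ _).symm)
    exact ⟨⟨(b, k), hk⟩, rfl⟩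
  choose N hN using next
  -- The action of stage 0 is the identity of `T.obj Y`, which forces the second section to be
  -- `R.act g`.
  let q : ∀ n, Q n := Nat.rec ⟨(g, R.act g), R.res_id _⟩ N
  refine ⟨fun n => (q n).1.1, rfl, fun n => ?_⟩
  have h : (q (n + 1)).1.1 = (q n).1.2 := hN n (q n)
  exact (congrArg (R.res (stageAct τ Y n)) h).trans (q n).2

/-- Stage 1 is forced because `stageAct` at 0 is an identity; later stages are forced by uniqueness
of gluing along the coequalizers. -/
lemma sections_unique (R : PresheafAlgebra T τ) (Y : V)
    (s s' : ∀ n, R.sec (stage τ Y n).dom) (h0 : s 0 = s' 0)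
    (hs : ∀ n, R.res (stageAct τ Y n) (s (n + 1)) = R.act (s n))
    (hs' : ∀ n, R.res (stageAct τ Y n) (s' (n + 1)) = R.act (s' n)) (n : ℕ) : s n = s' n := by
  have hst (s : ∀ n, R.sec (stage τ Y n).dom)
      (hs : ∀ n, R.res (stageAct τ Y n) (s (n + 1)) = R.act (s n)) (n : ℕ) :
      R.res (step τ Y n) (s (n + 1)) = s n := by
    rw [← unit_stageAct, R.res_comp, hs, R.res_unit]
  induction n with
  | zero => exact h0
  | succ n ih =>
    cases n with
    | zero =>
      have h := hs 0
      rw [h0, ← hs' 0] at h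
      exact (R.res_id (s 1)).symm.trans (h.trans (R.res_id (s' 1)))
    | succ n =>
      refine (Sections.existsUnique_of_coequalizer R.glue_coequalizers
        (T.map (step τ Y n)) (stageAct τ Y n ≫ τ.app _) (R.act (s (n + 1))) ?_).unique
        (hs (n + 1)) ((hs' (n + 1)).trans (congrArg R.act ih.symm))
      rw [R.res_act, hst s hs]
      exact ((hs n).symm.trans (congrArg _ (R.res_unit _).symm)).trans (R.res_comp _ _ _).symm

end PartialAction

/-- A free algebra of the pointed endofunctor `(T, τ)` on `Y`. -/
structure FreeAlgebra (T : V ⥤ V) (τ : 𝟭 V ⟶ T) (Y : V) where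
  pt : V
  act : T.obj pt ⟶ pt
  inc : Y ⟶ pt
  unit_act : τ.app pt ≫ act = 𝟙 pt
  existsUnique (R : PresheafAlgebra T τ) (g : R.sec Y) :
    ∃! h : R.sec pt, R.res inc h = g ∧ R.res act h = R.act h

open PartialAction in
/-- Free algebras of a pointed endofunctor preserving colimits of sequences. -/
lemma nonempty_freeAlgebra (T : V ⥤ V) (τ : 𝟭 V ⟶ T) [HasCoequalizers V]
    [HasColimitsOfShape ℕ V] [PreservesColimitsOfShape ℕ T] (Y : V) :
    Nonempty (FreeAlgebra T τ Y) := by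
  let F := Functor.ofSequence (step τ Y)
  let c : Cocone F := colimit.cocone F
  have hc : IsColimit c := colimit.isColimit F
  let i (n : ℕ) : (stage τ Y n).dom ⟶ c.pt := c.ι.app n
  have hi (n : ℕ) : step τ Y n ≫ i (n + 1) = i n := by
    have := c.w (homOfLE (Nat.le_succ n))
    rwa [Functor.ofSequence_map_homOfLE_succ] at this
  -- The partial action raises the stage by one, hence the leg through `i (n + 1)`.
  let d : Cocone (F ⋙ T) :=
    { pt := c.pt
      ι := NatTrans.ofSequence (F := F ⋙ T) (G := (Functor.const ℕ).obj c.pt)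
        (fun n => stageAct τ Y n ≫ i (n + 1)) (fun n => by
          have h1 : (F ⋙ T).map (homOfLE (Nat.le_add_right n 1)) = T.map (step τ Y n) :=
            congrArg T.map (Functor.ofSequence_map_homOfLE_succ (step τ Y) n)
          rw [h1]
          refine Eq.trans ?_ (Category.comp_id _).symm
          have h2 : T.map (step τ Y n) ≫ stageAct τ Y (n + 1) ≫ i (n + 1 + 1) =
              stageAct τ Y n ≫ i (n + 1) := by
            rw [← Category.assoc, map_step_stageAct, Category.assoc, hi]
          exact h2) }
  have hT : IsColimit (T.mapCocone c) := isColimitOfPreserves T hc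
  let a : T.obj c.pt ⟶ c.pt := hT.desc d
  have ha (n : ℕ) : T.map (i n) ≫ a = stageAct τ Y n ≫ i (n + 1) := hT.fac d n
  refine ⟨⟨c.pt, a, i 0, ?_, fun R g => ?_⟩⟩
  · refine hc.hom_ext fun n => ?_
    change i n ≫ τ.app c.pt ≫ a = i n ≫ 𝟙 _
    have := τ.naturality (i n)
    dsimp only [Functor.id_obj, Functor.id_map] at this
    rw [← Category.assoc, this, Category.assoc, ha, Category.comp_id,
      ← Category.assoc, unit_stageAct, hi]
  · obtain ⟨s, h0, hs⟩ := exists_sections τ R Y g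
    have hst (n : ℕ) : R.res (step τ Y n) (s (n + 1)) = s n := by
      rw [← unit_stageAct, R.res_comp, hs, R.res_unit]
    obtain ⟨k, hk, hu⟩ := Sections.existsUnique_of_sequence R.glue_sequential (step τ Y) c hc s hst
    have hik (n : ℕ) : R.res (i n) k = s n := hk n
    refine ⟨k, ⟨(hk 0).trans h0, ?_⟩, fun k' hk' => hu k' ?_⟩
    -- Both `R.res a k` and `R.act k` glue the sections `R.act (s n)` along the colimit preserved by
    -- `T`.
    · refine (R.glue_sequential (F ⋙ T) _ hT (fun n => R.act (s n)) ?_).unique ?_ ?_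
      · intro m n f
        refine (R.res_act _ _).trans (congrArg R.act ?_)
        rw [← hik n, ← hik m]
        refine (R.res_comp _ _ _).symm.trans ?_
        exact congrArg (R.res · k) (c.w f)
      · intro n
        change R.res (T.map (i n)) (R.res a k) = R.act (s n)
        rw [← R.res_comp, ha, R.res_comp, hik, hs]
      · intro n
        exact (R.res_act _ _).trans (congrArg R.act (hik n))
    -- The restrictions of any solution to the stages satisfy the recursion defining `s`.
    · refine sections_unique τ R Y _ s (hk'.1.trans h0.symm) (fun n => ?_) hs
      change R.res (stageAct τ Y n) (R.res (i (n + 1)) k') = R.act (R.res (i n) k')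
      rw [← R.res_comp, ← ha, R.res_comp, hk'.2, R.res_act]

end FreeAlgebra

/-! ### Free monoids on pointed objects -/

section FreeMonoid

open MonoidalCategory

variable {V : Type u₁} [Category.{v₁} V] [MonoidalCategory V]

/-- The point of the endofunctor `X ⊗ -` induced by a point of `X`. -/
@[simps]
def pointTensorLeft {X : V} (p : 𝟙_ V ⟶ X) : 𝟭 V ⟶ tensorLeft X where
  app Z := (λ_ Z).inv ≫ p ▷ Z
  naturality Z Z' f := by
    dsimp
    rw [leftUnitor_inv_naturality_assoc, Category.assoc, whisker_exchange]

/-- Precomposition of a presheaf algebra with `- ⊗ Y`. -/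
def PresheafAlgebra.shift {X : V} {p : 𝟙_ V ⟶ X}
    (R : PresheafAlgebra (tensorLeft X) (pointTensorLeft p)) (Y : V)
    [PreservesColimitsOfShape ℕ (tensorRight Y)]
    [PreservesColimitsOfShape WalkingParallelPair (tensorRight Y)] :
    PresheafAlgebra (tensorLeft X) (pointTensorLeft p) where
  sec Z := R.sec (Z ⊗ Y)
  res f s := R.res (f ▷ Y) s
  res_id s := by rw [id_whiskerRight, R.res_id]
  res_comp f g s := by rw [comp_whiskerRight, R.res_comp]
  glue_sequential F c hc s hs :=
    R.glue_sequential (F ⋙ tensorRight Y) _ (isColimitOfPreserves (tensorRight Y) hc) s hs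
  glue_coequalizers F c hc s hs :=
    R.glue_coequalizers (F ⋙ tensorRight Y) _ (isColimitOfPreserves (tensorRight Y) hc) s hs
  act {Z} s := R.res (α_ X Z Y).hom (R.act s)
  res_act f s := by
    rw [← R.res_act, ← R.res_comp, ← R.res_comp]
    exact congrArg (R.res · _) (associator_naturality_middle X f Y)
  res_unit {Z} s := by
    rw [← R.res_comp]
    refine Eq.trans (congrArg (R.res · _) ?_) (R.res_unit s)
    simp

/-- The representable presheaf algebra attached to an algebra. -/
def homAlgebra {X : V} (p : 𝟙_ V ⟶ X) (W : V) (a : X ⊗ W ⟶ W)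
    (ha : (pointTensorLeft p).app W ≫ a = 𝟙 W) :
    PresheafAlgebra (tensorLeft X) (pointTensorLeft p) where
  sec Z := Z ⟶ W
  res f s := f ≫ s
  res_id s := Category.id_comp s
  res_comp f g s := Category.assoc f g s
  glue_sequential F c hc s hs := by
    let d : Cocone F := ⟨W, ⟨s, fun i j f => (hs i j f).trans (Category.comp_id _).symm⟩⟩
    exact ⟨hc.desc d, hc.fac d, fun k hk => hc.uniq d k hk⟩
  glue_coequalizers F c hc s hs := by
    let d : Cocone F := ⟨W, ⟨s, fun i j f => (hs i j f).trans (Category.comp_id _).symm⟩⟩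
    exact ⟨hc.desc d, hc.fac d, fun k hk => hc.uniq d k hk⟩
  act s := X ◁ s ≫ a
  res_act f s := by simp
  res_unit {Z} s := by
    have := (pointTensorLeft p).naturality_assoc s a
    refine this.symm.trans ?_
    rw [ha]
    exact Category.comp_id s

namespace FreeAlgebra

variable {X : V} {p : 𝟙_ V ⟶ X} (S : FreeAlgebra (tensorLeft X) (pointTensorLeft p) (𝟙_ V))

/-- The action of `X` on the free algebra. -/
def smul : X ⊗ S.pt ⟶ S.pt := S.act

/-- The free algebra, as a presheaf algebra. -/
abbrev self : PresheafAlgebra (tensorLeft X) (pointTensorLeft p) :=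
  homAlgebra p S.pt S.smul S.unit_act

/-- The canonical morphism from the generating object to the free algebra. -/
def gen : X ⟶ S.pt := (ρ_ X).inv ≫ X ◁ S.inc ≫ S.smul

variable [∀ Y : V, PreservesColimitsOfShape ℕ (tensorRight Y)]
  [∀ Y : V, PreservesColimitsOfShape WalkingParallelPair (tensorRight Y)]

/-- The left unitor, a section over the unit object of the presheaf Hom(- ⊗ `S.pt`, `S.pt`), extends
uniquely to a map that is X-linear in the first variable. -/
lemma exists_mul : ∃ μ : S.pt ⊗ S.pt ⟶ S.pt, S.inc ▷ S.pt ≫ μ = (λ_ S.pt).hom ∧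
    S.smul ▷ S.pt ≫ μ = (α_ X S.pt S.pt).hom ≫ X ◁ μ ≫ S.smul :=
  (S.existsUnique (S.self.shift S.pt) (λ_ S.pt).hom).exists

/-- The multiplication of the free algebra. -/
noncomputable def mul : S.pt ⊗ S.pt ⟶ S.pt := S.exists_mul.choose

lemma inc_mul : S.inc ▷ S.pt ≫ S.mul = (λ_ S.pt).hom := S.exists_mul.choose_spec.1

lemma smul_mul : S.smul ▷ S.pt ≫ S.mul = (α_ X S.pt S.pt).hom ≫ X ◁ S.mul ≫ S.smul :=
  S.exists_mul.choose_spec.2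

/-- Both sides are X-linear in the first variable and agree on the unit object. -/
lemma mul_inc : S.pt ◁ S.inc ≫ S.mul = (ρ_ S.pt).hom := by
  refine (S.existsUnique (S.self.shift (𝟙_ V)) ((λ_ (𝟙_ V)).hom ≫ S.inc)).unique
    ⟨?_, ?_⟩ ⟨?_, ?_⟩
  · change S.inc ▷ 𝟙_ V ≫ S.pt ◁ S.inc ≫ S.mul = _
    rw [← whisker_exchange_assoc, inc_mul, leftUnitor_naturality]
  · change S.smul ▷ 𝟙_ V ≫ S.pt ◁ S.inc ≫ S.mul =
      (α_ _ _ _).hom ≫ X ◁ (S.pt ◁ S.inc ≫ S.mul) ≫ S.smul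
    rw [← whisker_exchange_assoc, smul_mul]
    simp
  · change S.inc ▷ 𝟙_ V ≫ (ρ_ S.pt).hom = _
    rw [rightUnitor_naturality, unitors_equal]
  · change S.smul ▷ 𝟙_ V ≫ (ρ_ S.pt).hom = (α_ _ _ _).hom ≫ X ◁ (ρ_ S.pt).hom ≫ S.smul
    rw [rightUnitor_naturality]
    simp

/-- Same principle as for the unit law, with two successive shifts, since two variables are left as
parameters. -/
lemma mul_assoc : S.mul ▷ S.pt ≫ S.mul =
    (α_ S.pt S.pt S.pt).hom ≫ S.pt ◁ S.mul ≫ S.mul := by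
  refine (S.existsUnique ((S.self.shift S.pt).shift S.pt)
    ((λ_ S.pt).hom ▷ S.pt ≫ S.mul)).unique ⟨?_, ?_⟩ ⟨?_, ?_⟩
  · change (S.inc ▷ S.pt) ▷ S.pt ≫ S.mul ▷ S.pt ≫ S.mul = _
    rw [← comp_whiskerRight_assoc, inc_mul]
  · change (S.smul ▷ S.pt) ▷ S.pt ≫ S.mul ▷ S.pt ≫ S.mul =
      (α_ _ _ _).hom ▷ S.pt ≫ (α_ _ _ _).hom ≫ X ◁ (S.mul ▷ S.pt ≫ S.mul) ≫ S.smul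
    rw [← comp_whiskerRight_assoc, smul_mul]
    simp [smul_mul]
  · change (S.inc ▷ S.pt) ▷ S.pt ≫ (α_ _ _ _).hom ≫ S.pt ◁ S.mul ≫ S.mul = _
    rw [associator_naturality_left_assoc, ← whisker_exchange_assoc, inc_mul,
      leftUnitor_naturality]
    simp
  · change (S.smul ▷ S.pt) ▷ S.pt ≫ (α_ _ _ _).hom ≫ S.pt ◁ S.mul ≫ S.mul =
      (α_ _ _ _).hom ▷ S.pt ≫ (α_ _ _ _).hom ≫
        X ◁ ((α_ _ _ _).hom ≫ S.pt ◁ S.mul ≫ S.mul) ≫ S.smul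
    rw [associator_naturality_left_assoc, ← whisker_exchange_assoc, smul_mul]
    simp

/-- Since multiplying by generators is the action, monoid morphisms out of `S.monoid` are
automatically X-linear. -/
lemma gen_mul : S.gen ▷ S.pt ≫ S.mul = S.smul := by
  have h : X ◁ S.inc ▷ S.pt ≫ X ◁ S.mul = X ◁ (λ_ S.pt).hom := by
    rw [← MonoidalCategory.whiskerLeft_comp, inc_mul]
  simp [gen, smul_mul, reassoc_of% h]

/-- The free monoid on a pointed object. -/
noncomputable def monoid : Mon V where
  X := S.pt
  mon :=
    { one := S.inc
      mul := S.mul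
      one_mul := S.inc_mul
      mul_one := S.mul_inc
      mul_assoc := S.mul_assoc }

end FreeAlgebra

end FreeMonoid

/-! ### Arrows between objects of different fibers -/

section Lifts

open MonoidalCategory

variable {E : Type u₁} [Category.{v₁} E] {G : Type u₂} [Category.{v₂} G] {A : E ⥤ G}

/-- The arrows over `b` between an object over `B` and an object over `B'`. -/
def Lift {B B' : G} (b : B ⟶ B') (X : A.Fiber B) (Y : A.Fiber B') :=
  {h : X.1 ⟶ Y.1 // A.IsHomLift b h}

lemma isHomLift_of_comp {B B' : G} (b : B ⟶ B') {X Y Z : E} (f : X ⟶ Y) (g : Y ⟶ Z)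
    [A.IsHomLift (𝟙 B) f] [A.IsHomLift b (f ≫ g)] : A.IsHomLift b g := by
  refine IsHomLift.of_fac' A b g (IsHomLift.codomain_eq A (𝟙 B) f)
    (IsHomLift.codomain_eq A b (f ≫ g)) ?_
  have h := IsHomLift.fac' A b (f ≫ g)
  rw [A.map_comp, IsHomLift.fac' A (𝟙 B) f] at h
  rw [← cancel_epi (eqToHom ((IsHomLift.domain_eq A (𝟙 B) f).trans
    (IsHomLift.codomain_eq A (𝟙 B) f).symm))]
  simpa using h

namespace Lift

variable {B B' : G} {b : B ⟶ B'}

@[ext]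
lemma ext {X : A.Fiber B} {Y : A.Fiber B'} {h k : Lift b X Y} (e : h.1 = k.1) : h = k :=
  Subtype.ext e

/-- Precomposition with an arrow of the fiber. -/
def pre {X Y : A.Fiber B} {Z : A.Fiber B'} (f : X ⟶ Y) (h : Lift b Y Z) : Lift b X Z :=
  ⟨f.1 ≫ h.1, haveI := h.2; inferInstance⟩

/-- Postcomposition with an arrow of the fiber. -/
def post {X : A.Fiber B} {Y Z : A.Fiber B'} (h : Lift b X Y) (f : Y ⟶ Z) : Lift b X Z :=
  ⟨h.1 ≫ f.1, haveI := h.2; inferInstance⟩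

lemma id_pre {X : A.Fiber B} {Z : A.Fiber B'} (h : Lift b X Z) : pre (𝟙 X) h = h :=
  ext (Category.id_comp h.1)

lemma post_id {X : A.Fiber B} {Z : A.Fiber B'} (h : Lift b X Z) : post h (𝟙 Z) = h :=
  ext (Category.comp_id h.1)

lemma pre_pre {X Y Y' : A.Fiber B} {Z : A.Fiber B'} (f : X ⟶ Y) (g : Y ⟶ Y')
    (h : Lift b Y' Z) : pre f (pre g h) = pre (f ≫ g) h :=
  ext (Category.assoc f.1 g.1 h.1).symm

lemma post_post {X : A.Fiber B} {Y Z Z' : A.Fiber B'} (h : Lift b X Y) (f : Y ⟶ Z)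
    (g : Z ⟶ Z') : post (post h f) g = post h (f ≫ g) :=
  ext (Category.assoc h.1 f.1 g.1)

lemma pre_post {X Y : A.Fiber B} {Z Z' : A.Fiber B'} (f : X ⟶ Y) (h : Lift b Y Z)
    (g : Z ⟶ Z') : pre f (post h g) = post (pre f h) g :=
  ext (Category.assoc f.1 h.1 g.1).symm

/-- Gluing of arrows over `b` along a colimit in the fiber over `B`. -/
lemma existsUnique_glue {J : Type} [Category.{0} J] (j₀ : J)
    [PreservesColimitsOfShape J (Functor.Fiber.fiberInclusion : A.Fiber B ⥤ E)]
    {W : A.Fiber B'} (F : J ⥤ A.Fiber B) (c : Cocone F) (hc : IsColimit c)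
    (s : ∀ j, Lift b (F.obj j) W)
    (hs : ∀ (i j : J) (f : i ⟶ j), pre (F.map f) (s j) = s i) :
    ∃! k : Lift b c.pt W, ∀ j, pre (c.ι.app j) k = s j := by
  have hE := isColimitOfPreserves (Functor.Fiber.fiberInclusion : A.Fiber B ⥤ E) hc
  let d : Cocone (F ⋙ (Functor.Fiber.fiberInclusion : A.Fiber B ⥤ E)) :=
    ⟨W.1, ⟨fun j => (s j).1, fun i j f =>
      (congrArg Subtype.val (hs i j f)).trans (Category.comp_id _).symm⟩⟩
  have hd (j : J) : (c.ι.app j).1 ≫ hE.desc d = (s j).1 := hE.fac d j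
  -- The colimit in `E` does not control the base of the glued arrow; one vertical leg, at `j₀`, is
  -- enough to identify it.
  have hlift : A.IsHomLift b (hE.desc d) := by
    have h := (s j₀).2
    rw [← hd j₀] at h
    exact isHomLift_of_comp b (c.ι.app j₀).1 _
  exact ⟨⟨hE.desc d, hlift⟩, fun j => ext (hd j),
    fun k hk => ext (hE.uniq d k.1 fun j => congrArg Subtype.val (hk j))⟩

variable [MonoidalOvercategory A]

/-- The tensor product of two arrows over `b`. -/
def tens {X Y : A.Fiber B} {X' Y' : A.Fiber B'} (f : Lift b X X') (g : Lift b Y Y') :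
    Lift b (X ⊗ Y) (X' ⊗ Y') :=
  haveI := f.2
  haveI := g.2
  ⟨tensorHom b f.1 g.1, tensorHom_isHomLift b f.1 g.1⟩

/-- The arrow `I(b)`. -/
def unit (b : B ⟶ B') : Lift b (𝟙_ (A.Fiber B)) (𝟙_ (A.Fiber B')) :=
  ⟨unitMap A b, unitMap_isHomLift b⟩

lemma tens_pre {X Y X₁ Y₁ : A.Fiber B} {X' Y' : A.Fiber B'} (u : X ⟶ X₁) (v : Y ⟶ Y₁)
    (f : Lift b X₁ X') (g : Lift b Y₁ Y') :
    tens (pre u f) (pre v g) = pre (u ⊗ₘ v) (tens f g) := by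
  have := f.2
  have := g.2
  have := (pre u f).2
  have := (pre v g).2
  refine ext (Eq.trans ?_ (tensorHom_comp (𝟙 B) b u.1 v.1 f.1 g.1).symm)
  exact tensorHom_congr (Category.id_comp b).symm _ _

lemma tens_post {X Y : A.Fiber B} {X' Y' X₁ Y₁ : A.Fiber B'} (f : Lift b X X')
    (g : Lift b Y Y') (u : X' ⟶ X₁) (v : Y' ⟶ Y₁) :
    tens (post f u) (post g v) = post (tens f g) (u ⊗ₘ v) := by
  have := f.2
  have := g.2
  have := (post f u).2
  have := (post g v).2
  refine ext (Eq.trans ?_ (tensorHom_comp b (𝟙 B') f.1 g.1 u.1 v.1).symm)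
  exact tensorHom_congr (Category.comp_id b).symm _ _

lemma pre_whiskerLeft {X Y Y₁ : A.Fiber B} {X' Y' : A.Fiber B'} (v : Y ⟶ Y₁)
    (f : Lift b X X') (g : Lift b Y₁ Y') :
    pre (X ◁ v) (tens f g) = tens f (pre v g) := by
  rw [← MonoidalCategory.id_tensorHom, ← tens_pre, id_pre]

lemma pre_whiskerRight {X X₁ Y : A.Fiber B} {X' Y' : A.Fiber B'} (u : X ⟶ X₁)
    (f : Lift b X₁ X') (g : Lift b Y Y') :
    pre (u ▷ Y) (tens f g) = tens (pre u f) g := by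
  rw [← MonoidalCategory.tensorHom_id, ← tens_pre, id_pre]

lemma tens_post_left {X Y : A.Fiber B} {X' Y' X₁ : A.Fiber B'} (f : Lift b X X')
    (g : Lift b Y Y') (u : X' ⟶ X₁) : tens (post f u) g = post (tens f g) (u ▷ Y') := by
  rw [← MonoidalCategory.tensorHom_id, ← tens_post, post_id]

lemma tens_post_right {X Y : A.Fiber B} {X' Y' Y₁ : A.Fiber B'} (f : Lift b X X')
    (g : Lift b Y Y') (v : Y' ⟶ Y₁) : tens f (post g v) = post (tens f g) (X' ◁ v) := by
  rw [← MonoidalCategory.id_tensorHom, ← tens_post, post_id]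

lemma tens_associator {X Y Z : A.Fiber B} {X' Y' Z' : A.Fiber B'} (f : Lift b X X')
    (g : Lift b Y Y') (h : Lift b Z Z') :
    post (tens (tens f g) h) (α_ X' Y' Z').hom = pre (α_ X Y Z).hom (tens f (tens g h)) := by
  have := f.2
  have := g.2
  have := h.2
  exact ext (MonoidalOvercategory.associator_naturality b f.1 g.1 h.1)

lemma tens_leftUnitor {X : A.Fiber B} {X' : A.Fiber B'} (f : Lift b X X') :
    post (tens (unit b) f) (λ_ X').hom = pre (λ_ X).hom f := by
  have := f.2
  exact ext (MonoidalOvercategory.leftUnitor_naturality b f.1)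

lemma tens_rightUnitor {X : A.Fiber B} {X' : A.Fiber B'} (f : Lift b X X') :
    post (tens f (unit b)) (ρ_ X').hom = pre (ρ_ X).hom f := by
  have := f.2
  exact ext (MonoidalOvercategory.rightUnitor_naturality b f.1)

/-- The arrows over `b` into a monoid, as a presheaf algebra. -/
def algebra {X : A.Fiber B} (p : 𝟙_ (A.Fiber B) ⟶ X)
    [PreservesColimitsOfShape ℕ (Functor.Fiber.fiberInclusion : A.Fiber B ⥤ E)]
    [PreservesColimitsOfShape WalkingParallelPair
      (Functor.Fiber.fiberInclusion : A.Fiber B ⥤ E)]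
    (C : Mon (A.Fiber B')) (f : Lift b X C.X) (hf : pre p f = post (unit b) C.mon.one) :
    PresheafAlgebra (tensorLeft X) (pointTensorLeft p) where
  sec Z := Lift b Z C.X
  res u h := pre u h
  res_id := id_pre
  res_comp u v h := (pre_pre u v h).symm
  glue_sequential F c hc s hs := existsUnique_glue 0 F c hc s hs
  glue_coequalizers F c hc s hs := existsUnique_glue .zero F c hc s hs
  act h := post (tens f h) C.mon.mul
  res_act u h := by
    refine (pre_post _ _ _).trans ?_
    exact congrArg (post · C.mon.mul) (pre_whiskerLeft u f h)
  res_unit {Z} h := by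
    refine (pre_post _ _ _).trans ?_
    -- By `hf`, the point of X acts through the unit of `C`, hence trivially.
    rw [pointTensorLeft_app, ← pre_pre, pre_whiskerRight, hf, tens_post_left, pre_post,
      post_post, MonObj.one_mul, ← pre_post, tens_leftUnitor, pre_pre, Iso.inv_hom_id, id_pre]

/-- An arrow over `b` between two monoids is compatible with their structures. -/
def IsMonHom {B B' : G} {b : B ⟶ B'} {C : Mon (A.Fiber B)} {D : Mon (A.Fiber B')}
    (h : Lift b C.X D.X) : Prop :=
  pre C.mon.mul h = post (tens h h) D.mon.mul ∧ pre C.mon.one h = post (unit b) D.mon.one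

end Lift

namespace FreeAlgebra

open Lift

variable [MonoidalOvercategory A] {B : G} {X : A.Fiber B} {p : 𝟙_ (A.Fiber B) ⟶ X}
  (S : FreeAlgebra (tensorLeft X) (pointTensorLeft p) (𝟙_ (A.Fiber B)))
  [∀ Y : A.Fiber B, PreservesColimitsOfShape ℕ (tensorRight Y)]
  [∀ Y : A.Fiber B, PreservesColimitsOfShape WalkingParallelPair (tensorRight Y)]
  [PreservesColimitsOfShape ℕ (Functor.Fiber.fiberInclusion : A.Fiber B ⥤ E)]
  [PreservesColimitsOfShape WalkingParallelPair
    (Functor.Fiber.fiberInclusion : A.Fiber B ⥤ E)]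

/-- The universal property of the free monoid, with respect to arrows over any `b`. -/
lemma existsUnique_isMonHom {B' : G} {b : B ⟶ B'} (C : Mon (A.Fiber B')) (f : Lift b X C.X)
    (hf : pre p f = post (unit b) C.mon.one) :
    ∃! h : Lift b S.monoid.X C.X, h.IsMonHom ∧ pre S.gen h = f := by
  obtain ⟨h, ⟨h₁, h₂⟩, hu⟩ : ∃! h : Lift b S.pt C.X, pre S.inc h = post (unit b) C.mon.one ∧
      pre S.smul h = post (tens f h) C.mon.mul :=
    S.existsUnique (algebra p C f hf) (post (unit b) C.mon.one)
  refine ⟨h, ⟨⟨?_, h₁⟩, ?_⟩, ?_⟩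
  -- Multiplicativity: both composites extend the same section on the unit object, linearly in the
  -- first variable.
  · refine (S.existsUnique ((algebra p C f hf).shift S.pt) (pre (λ_ S.pt).hom h)).unique
      ⟨?_, ?_⟩ ⟨?_, ?_⟩
    · change pre (S.inc ▷ S.pt) (pre S.mul h) = _
      rw [pre_pre, inc_mul]
    · change pre (S.smul ▷ S.pt) (pre S.mul h) =
        pre (α_ _ _ _).hom (post (tens f (pre S.mul h)) C.mon.mul)
      rw [pre_pre, smul_mul, ← pre_pre, ← pre_pre, h₂, pre_post (X ◁ _), pre_whiskerLeft]
    · change pre (S.inc ▷ S.pt) (post (tens h h) C.mon.mul) = _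
      rw [pre_post, pre_whiskerRight, h₁, tens_post_left, post_post, MonObj.one_mul,
        tens_leftUnitor]
    · change pre (S.smul ▷ S.pt) (post (tens h h) C.mon.mul) =
        pre (α_ _ _ _).hom (post (tens f (post (tens h h) C.mon.mul)) C.mon.mul)
      rw [pre_post, pre_whiskerRight, h₂, tens_post_left, post_post, MonObj.mul_assoc,
        tens_post_right, post_post, ← post_post, tens_associator, pre_post]
  · rw [gen, ← pre_pre, ← pre_pre, h₂, pre_post (X ◁ _), pre_whiskerLeft, h₁, tens_post_right,
      post_post, MonObj.mul_one, tens_rightUnitor, pre_pre, Iso.inv_hom_id, id_pre]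
  · rintro (k : Lift b S.pt C.X) ⟨⟨k₁, k₂⟩, k₃⟩
    refine hu k ⟨k₂, ?_⟩
    change pre S.mul k = post (tens k k) C.mon.mul at k₁
    change pre S.gen k = f at k₃
    rw [← gen_mul, ← pre_pre, k₁, pre_post, pre_whiskerRight, k₃]

end FreeAlgebra

end Lifts

/-! ### Uniqueness of base arrows, and vertical squares in arrow fibers. -/

variable {E : Type u₁} [Category.{v₁} E] {G : Type u₂} [Category.{v₂} G] {A : E ⥤ G}

lemma isHomLift_unique {B B' : G} {b b' : B ⟶ B'} {X Y : E} (f : X ⟶ Y)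
    (h : A.IsHomLift b f) (h' : A.IsHomLift b' f) : b = b' :=
  (IsHomLift.fac A b f).trans (IsHomLift.fac A b' f).symm

lemma arrow_eqToHom_left {f g : Arrow G} (h : f = g) :
    CommaMorphism.left (eqToHom h) = eqToHom (congrArg Comma.left h) := by
  subst h
  rfl

lemma arrow_eqToHom_right {f g : Arrow G} (h : f = g) :
    CommaMorphism.right (eqToHom h) = eqToHom (congrArg Comma.right h) := by
  subst h
  rfl

lemma isHomLift_left {c : Arrow G} {f g : Arrow E} (m : f ⟶ g)
    (h : A.mapArrow.IsHomLift (𝟙 c) m) : A.IsHomLift (𝟙 c.left) (CommaMorphism.left m) := by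
  refine IsHomLift.of_fac' A _ _ (congrArg Comma.left (IsHomLift.domain_eq A.mapArrow (𝟙 c) m))
    (congrArg Comma.left (IsHomLift.codomain_eq A.mapArrow (𝟙 c) m)) ?_
  have e := IsHomLift.fac' A.mapArrow (𝟙 c) m
  rw [Category.id_comp, eqToHom_trans] at e
  refine ((congrArg CommaMorphism.left e).trans (arrow_eqToHom_left _)).trans ?_
  exact ((congrArg (_ ≫ ·) (Category.id_comp _)).trans (eqToHom_trans _ _)).symm

lemma isHomLift_right {c : Arrow G} {f g : Arrow E} (m : f ⟶ g)
    (h : A.mapArrow.IsHomLift (𝟙 c) m) : A.IsHomLift (𝟙 c.right) (CommaMorphism.right m) := by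
  refine IsHomLift.of_fac' A _ _ (congrArg Comma.right (IsHomLift.domain_eq A.mapArrow (𝟙 c) m))
    (congrArg Comma.right (IsHomLift.codomain_eq A.mapArrow (𝟙 c) m)) ?_
  have e := IsHomLift.fac' A.mapArrow (𝟙 c) m
  rw [Category.id_comp, eqToHom_trans] at e
  refine ((congrArg CommaMorphism.right e).trans (arrow_eqToHom_right _)).trans ?_
  exact ((congrArg (_ ≫ ·) (Category.id_comp _)).trans (eqToHom_trans _ _)).symm

/-- An object of `E`, as an object of its fiber. -/
abbrev inFiber (A : E ⥤ G) (X : E) : A.Fiber (A.obj X) := Functor.Fiber.mk rfl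

variable [MonoidalOvercategory A]

namespace OverMon

/-- A morphism of overmonoids, as an arrow over its base. -/
def Hom.lift {C D : OverMon A} (f : C ⟶ D) : Lift (Hom.base f) C.mon.X D.mon.X :=
  ⟨Hom.hom f, Hom.isHomLift f⟩

lemma Hom.isMonHom {C D : OverMon A} (f : C ⟶ D) : (Hom.lift f).IsMonHom :=
  ⟨Subtype.ext (Hom.map_mul f), Subtype.ext (Hom.map_one f)⟩

/-- The morphism of overmonoids given by an arrow compatible with the structures. -/
def Hom.ofLift {C D : OverMon A} {b : C.base ⟶ D.base} (h : Lift b C.mon.X D.mon.X)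
    (hh : h.IsMonHom) : C ⟶ D :=
  Hom.mk (C := C) (D := D) b h.1 h.2 (congrArg Subtype.val hh.1) (congrArg Subtype.val hh.2)

lemma hom_ext {C D : OverMon A} {f g : C ⟶ D} (h : Hom.hom f = Hom.hom g) : f = g :=
  Hom.ext (isHomLift_unique _ (Hom.isHomLift f) (h ▸ Hom.isHomLift g)) h

lemma comp_hom {C D K : OverMon A} (f : C ⟶ D) (g : D ⟶ K) :
    Hom.hom (f ≫ g) = Hom.hom f ≫ Hom.hom g := rfl

end OverMon

/-! ### The left overadjoint -/

section FreeOvermonoid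

/-- Every arrow over `b` preserves the canonical points. -/
lemma Lift.pre_point (hB : ∀ B : G, Nonempty (IsInitial (unitObj A B)))
    (hb : ∀ (B B' : G) (b : B ⟶ B'), Nonempty (IsInitial (unitArrow A b)))
    {B B' : G} {b : B ⟶ B'} {X : A.Fiber B} {Y : A.Fiber B'} (f : Lift b X Y)
    (p : unitObj A B ⟶ X) (q : unitObj A B' ⟶ Y) : Lift.pre p f = Lift.post (Lift.unit b) q := by
  have hf : A.mapArrow.obj (Arrow.mk f.1) = Arrow.mk b := by
    obtain ⟨X, rfl⟩ := X
    obtain ⟨Y, rfl⟩ := Y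
    have := f.2
    exact congrArg Arrow.mk (IsHomLift.eq_of_isHomLift A b f.1).symm
  -- The sides of the initial square from I(b) to `f` are vertical, so by initiality in the fibers
  -- they are `p` and `q`; the square commutes.
  let m : unitArrow A b ⟶ ⟨Arrow.mk f.1, hf⟩ := (hb B B' b).some.to _
  have hl : A.IsHomLift (𝟙 B) m.1.left := isHomLift_left m.1 m.2
  have hr : A.IsHomLift (𝟙 B') m.1.right := isHomLift_right m.1 m.2
  have hp : p = ⟨m.1.left, hl⟩ := (hB B).some.hom_ext _ _
  have hq : q = ⟨m.1.right, hr⟩ := (hB B').some.hom_ext _ _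
  subst hp hq
  exact Lift.ext m.1.w

/-- Points are preserved automatically, so the universal property for point-preserving arrows
applies to all arrows out of X, whatever their base. -/
lemma exists_universal (hA : IsLiberal A) (hB : ∀ B : G, Nonempty (IsInitial (unitObj A B)))
    (hb : ∀ (B B' : G) (b : B ⟶ B'), Nonempty (IsInitial (unitArrow A b))) (X : E) :
    ∃ (N : Mon (A.Fiber (A.obj X))) (η : inFiber A X ⟶ N.X),
      ∀ C : OverMon A, Function.Bijective
        (fun f : (⟨A.obj X, N⟩ : OverMon A) ⟶ C => η.1 ≫ OverMon.Hom.hom f) := by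
  have hV := hA.fiber (A.obj X)
  have := hV.hasSequentialColimits
  have := hV.hasCoequalizers
  have := hV.tensorRight_sequential
  have := hV.tensorLeft_sequential
  have := hV.tensorRight_coequalizers
  have := hA.inclusion_coequalizers (A.obj X)
  have := hA.inclusion_sequential (A.obj X)
  let X' := inFiber A X
  let p : unitObj A (A.obj X) ⟶ X' := (hB (A.obj X)).some.to X'
  obtain ⟨S⟩ := nonempty_freeAlgebra (MonoidalCategory.tensorLeft X') (pointTensorLeft p)
    (unitObj A (A.obj X))
  refine ⟨S.monoid, S.gen, fun C => ⟨fun f g hfg => ?_, fun f => ?_⟩⟩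
  · have hfg' : S.gen.1 ≫ OverMon.Hom.hom f = S.gen.1 ≫ OverMon.Hom.hom g := hfg
    -- As `S.gen` is vertical, the common composite determines the base.
    have hbase : OverMon.Hom.base f = OverMon.Hom.base g := by
      refine isHomLift_unique (S.gen.1 ≫ OverMon.Hom.hom f)
        (Lift.pre S.gen (OverMon.Hom.lift f)).2 ?_
      rw [hfg']
      exact (Lift.pre S.gen (OverMon.Hom.lift g)).2
    let g' : Lift (OverMon.Hom.base f) S.monoid.X C.mon.X :=
      ⟨OverMon.Hom.hom g, hbase ▸ OverMon.Hom.isHomLift g⟩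
    have hg' : g'.IsMonHom := by
      have key : ∀ (b : A.obj X ⟶ C.base) (e : OverMon.Hom.base g = b),
          Lift.IsMonHom (C := S.monoid) (D := C.mon)
            (⟨OverMon.Hom.hom g, e ▸ OverMon.Hom.isHomLift g⟩ : Lift b S.monoid.X C.mon.X) := by
        rintro b rfl
        exact OverMon.Hom.isMonHom g
      exact key _ hbase.symm
    have hu := (S.existsUnique_isMonHom C.mon (Lift.pre S.gen (OverMon.Hom.lift f))
      (Lift.pre_point hB hb _ p _)).unique ⟨OverMon.Hom.isMonHom f, rfl⟩
      ⟨hg', Lift.ext hfg'.symm⟩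
    exact OverMon.hom_ext (congrArg Subtype.val hu)
  -- The arity of the carrier equals `C.base` only propositionally, hence the `eqToHom`.
  · let f' : Lift (A.map f ≫ eqToHom C.mon.X.2) X' C.mon.X :=
      ⟨f, (IsHomLift.lift_comp_eqToHom_iff A (A.map f) f C.mon.X.2).2 (IsHomLift.map A f)⟩
    obtain ⟨h, ⟨h₁, h₂⟩, -⟩ := S.existsUnique_isMonHom C.mon f' (Lift.pre_point hB hb _ p _)
    exact ⟨OverMon.Hom.ofLift h h₁, congrArg Subtype.val h₂⟩

theorem exists_leftOveradjoint (hA : IsLiberal A)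
    (hB : ∀ B : G, Nonempty (IsInitial (unitObj A B)))
    (hb : ∀ (B B' : G) (b : B ⟶ B'), Nonempty (IsInitial (unitArrow A b))) :
    ∃ M : E ⥤ OverMon A,
      Nonempty (OverAdjunction A (OverMon.arity A) M (OverMon.forget A)) := by
  choose N η hη using exists_universal hA hB hb
  let e (X : E) (C : OverMon A) : ((⟨A.obj X, N X⟩ : OverMon A) ⟶ C) ≃
      (X ⟶ (OverMon.forget A).obj C) := Equiv.ofBijective _ (hη X C)
  have he (X : E) (C D : OverMon A) (g : C ⟶ D) (h : (⟨A.obj X, N X⟩ : OverMon A) ⟶ C) :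
      e X D (h ≫ g) = e X C h ≫ (OverMon.forget A).map g := (Category.assoc _ _ _).symm
  let M := Adjunction.leftAdjointOfEquiv e he
  let adj : M ⊣ OverMon.forget A := Adjunction.adjunctionOfEquivLeft e he
  have hunit (X : E) : adj.unit.app X = (η X).1 := by
    change (Adjunction.adjunctionOfEquivLeft e he).unit.app X = _
    rw [Adjunction.adjunctionOfEquivLeft_unit_app]
    exact Category.comp_id _
  have hunit' (X : E) : A.IsHomLift (𝟙 (A.obj X)) (adj.unit.app X) := hunit X ▸ (η X).2
  refine ⟨M, ⟨⟨?_, OverMon.forget_over A, adj, hunit', fun C => ?_⟩⟩⟩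
  · refine CategoryTheory.Functor.ext (fun X => rfl) fun X Y f => ?_
    refine Eq.trans ?_ ((Category.id_comp _).trans (Category.comp_id (A.map f))).symm
    -- The units are vertical, so naturality identifies the base of `M.map f` with `A.map f`.
    have h : f ≫ (η Y).1 = (η X).1 ≫ OverMon.Hom.hom (M.map f) := by
      rw [← hunit, ← hunit]
      exact adj.unit.naturality f
    refine isHomLift_unique (A := A) (b := OverMon.Hom.base (M.map f)) (f ≫ (η Y).1) ?_ ?_
    · rw [h]
      exact (Lift.pre (η X) (OverMon.Hom.lift (M.map f))).2
    · exact (Lift.post (⟨f, IsHomLift.map A f⟩ : Lift (A.map f) (inFiber A X) (inFiber A Y))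
        (η Y)).2
  -- The triangle identity and verticality of the unit force the counit to be vertical.
  · have h : (η C.carrier).1 ≫ OverMon.Hom.hom (adj.counit.app C) = 𝟙 C.carrier := by
      rw [← hunit]
      exact adj.right_triangle_components C
    have hl : A.IsHomLift (OverMon.Hom.base (adj.counit.app C)) (𝟙 C.carrier) := by
      rw [← h]
      exact (Lift.pre (η C.carrier) (OverMon.Hom.lift (adj.counit.app C))).2
    refine IsHomLift.of_fac' _ _ _ C.mon.X.2 rfl ?_
    refine (IsHomLift.fac A (OverMon.Hom.base (adj.counit.app C)) (𝟙 C.carrier)).trans ?_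
    rw [A.map_id]
    refine (congrArg (_ ≫ ·) (Category.id_comp _)).trans ?_
    refine Eq.trans ?_ (congrArg (_ ≫ ·) (Category.id_comp _)).symm
    exact (eqToHom_trans _ _).trans (eqToHom_trans _ _).symm

end FreeOvermonoid

/-! ### Creation of split coequalizers -/

section SplitMonoid

open MonoidalCategory

variable {V : Type u₁} [Category.{v₁} V] [MonoidalCategory V]

/-- The forgetful functor from monoids creates split coequalizers. -/
lemma existsUnique_monObj_of_split {N R : Mon V} {X : V} (u v : R ⟶ N) (η : X ⟶ N.X)
    (x : N.X ⟶ X) (s : N.X ⟶ R.X) (hηx : η ≫ x = 𝟙 X) (hsu : s ≫ u.hom = x ≫ η)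
    (hsv : s ≫ v.hom = 𝟙 N.X) (hx : u.hom ≫ x = v.hom ≫ x) :
    ∃! m : MonObj X, N.mon.mul ≫ x = (x ⊗ₘ x) ≫ m.mul ∧ N.mon.one ≫ x = m.one := by
  -- Replace `x ≫ η` by `s ≫ u.hom`, move the multiplication past `u`, exchange `u` for `v` using
  -- `hx`, and come back by `s ≫ v.hom = 𝟙`.
  have hmul : (x ⊗ₘ x) ≫ (η ⊗ₘ η) ≫ N.mon.mul ≫ x = N.mon.mul ≫ x := by
    have hu : R.mon.mul ≫ u.hom = (u.hom ⊗ₘ u.hom) ≫ N.mon.mul := IsMonHom.mul_hom u.hom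
    have hv : R.mon.mul ≫ v.hom = (v.hom ⊗ₘ v.hom) ≫ N.mon.mul := IsMonHom.mul_hom v.hom
    rw [tensorHom_comp_tensorHom_assoc, ← hsu, ← tensorHom_comp_tensorHom_assoc, ← reassoc_of% hu,
      hx, reassoc_of% hv, tensorHom_comp_tensorHom_assoc, hsv, id_tensorHom_id, Category.id_comp]
  have hηη : (η ⊗ₘ η) ≫ (x ⊗ₘ x) = 𝟙 (X ⊗ X) := by
    rw [tensorHom_comp_tensorHom, hηx, id_tensorHom_id]
  -- Every functor preserves split epimorphisms, so the monoid laws can be checked after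
  -- precomposing with tensor powers of `x`.
  have : IsSplitEpi x := ⟨⟨η, hηx⟩⟩
  have eL (W : V) : Epi (W ◁ x) := inferInstanceAs (Epi ((tensorLeft W).map x))
  have eR (W : V) : Epi (x ▷ W) := inferInstanceAs (Epi ((tensorRight W).map x))
  obtain ⟨m, hm⟩ : ∃ m : X ⊗ X ⟶ X, (x ⊗ₘ x) ≫ m = N.mon.mul ≫ x := ⟨_, hmul⟩
  refine ⟨{ one := N.mon.one ≫ x, mul := m, one_mul := ?_, mul_one := ?_, mul_assoc := ?_ },
    ⟨hm.symm, rfl⟩, ?_⟩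
  · rw [← cancel_epi (𝟙_ V ◁ x), comp_whiskerRight_assoc, whisker_exchange_assoc,
      whisker_exchange_assoc, ← MonoidalCategory.tensorHom_def_assoc, hm, MonObj.one_mul_assoc,
      leftUnitor_naturality]
  · rw [← cancel_epi (x ▷ 𝟙_ V), MonoidalCategory.whiskerLeft_comp_assoc,
      ← whisker_exchange_assoc, ← MonoidalCategory.tensorHom_def_assoc, hm, MonObj.mul_one_assoc,
      rightUnitor_naturality]
  · have e : IsSplitEpi ((x ⊗ₘ x) ⊗ₘ x) := ⟨⟨(η ⊗ₘ η) ⊗ₘ η, by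
      rw [tensorHom_comp_tensorHom, hηη, hηx, id_tensorHom_id]⟩⟩
    rw [← cancel_epi ((x ⊗ₘ x) ⊗ₘ x), associator_naturality_assoc,
      ← MonoidalCategory.tensorHom_id, ← MonoidalCategory.id_tensorHom,
      tensorHom_comp_tensorHom_assoc, tensorHom_comp_tensorHom_assoc, hm, Category.comp_id]
    have h₁ : ((N.mon.mul ≫ x) ⊗ₘ x) = N.mon.mul ▷ N.X ≫ (x ⊗ₘ x) := by
      simp [MonoidalCategory.tensorHom_def]
    have h₂ : (x ⊗ₘ (N.mon.mul ≫ x)) = N.X ◁ N.mon.mul ≫ (x ⊗ₘ x) := by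
      simp [tensorHom_def']
    rw [h₁, h₂, Category.assoc, Category.assoc, hm, MonObj.mul_assoc_assoc]
  · rintro m ⟨h₁, h₂⟩
    -- A multiplication determines its unit, so only the multiplications need comparing.
    refine MonObj.ext _ _ ?_
    have h := hm.trans h₁
    simpa [reassoc_of% hηη] using (congrArg ((η ⊗ₘ η) ≫ ·) h).symm

end SplitMonoid

section SplitOvermonoid

open MonoidalCategory

variable {E : Type u₁} [Category.{v₁} E] {G : Type u₂} [Category.{v₂} G] {A : E ⥤ G}
  [MonoidalOvercategory A]

namespace OverMon

lemma exists_hom_iff {B : G} {N M : Mon (A.Fiber B)} (x : N.X ⟶ M.X) :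
    (∃ f : (⟨B, N⟩ : OverMon A) ⟶ ⟨B, M⟩, Hom.hom f = x.1) ↔
      N.mon.mul ≫ x = (x ⊗ₘ x) ≫ M.mon.mul ∧ N.mon.one ≫ x = M.mon.one := by
  have hone : unitMap A (𝟙 B) ≫ M.mon.one.1 = M.mon.one.1 := by
    rw [unitMap_id]
    exact Category.id_comp _
  constructor
  · rintro ⟨⟨b, h, hl, hm, ho⟩, hx⟩
    change h = x.1 at hx
    subst hx
    obtain rfl : b = 𝟙 B := isHomLift_unique x.1 hl x.2
    exact ⟨Subtype.ext hm, Subtype.ext (ho.trans hone)⟩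
  · rintro ⟨h₁, h₂⟩
    exact ⟨Hom.mk (C := ⟨B, N⟩) (D := ⟨B, M⟩) (𝟙 B) x.1 x.2 (congrArg Subtype.val h₁)
      ((congrArg Subtype.val h₂).trans hone.symm), rfl⟩

/-- The structure of overmonoid induced on a split coequalizer. -/
lemma existsUnique_monObj_of_split {Q R : OverMon A} (u v : R ⟶ Q) {X : E}
    (η : X ⟶ Q.carrier) (x : Q.carrier ⟶ X) (s : Q.carrier ⟶ R.carrier)
    (hη : A.IsHomLift (𝟙 (A.obj X)) η) (hs : A.IsHomLift (𝟙 (A.obj Q.carrier)) s)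
    (hηx : η ≫ x = 𝟙 X) (hsu : s ≫ Hom.hom u = x ≫ η) (hsv : s ≫ Hom.hom v = 𝟙 Q.carrier)
    (hx : Hom.hom u ≫ x = Hom.hom v ≫ x) :
    ∃! m : MonObj (inFiber A X),
      ∃ f : Q ⟶ (⟨A.obj X, { X := inFiber A X, mon := m }⟩ : OverMon A), Hom.hom f = x := by
  -- The splittings are vertical, so all the data lie in one fiber.
  have hQ : Q.base = A.obj X := Q.mon.X.2.symm.trans (IsHomLift.codomain_eq A (𝟙 (A.obj X)) η)
  have hR : R.base = A.obj X := R.mon.X.2.symm.trans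
    ((IsHomLift.codomain_eq A (𝟙 (A.obj Q.carrier)) s).trans (Q.mon.X.2.trans hQ))
  obtain ⟨B, N⟩ := Q
  obtain ⟨B', N'⟩ := R
  dsimp only at hQ hR
  subst hQ hR
  have hx' : A.IsHomLift (𝟙 (A.obj X)) x := by
    have : A.IsHomLift (𝟙 (A.obj X)) (η ≫ x) := hηx ▸ IsHomLift.id rfl
    exact isHomLift_of_comp _ η x
  have hs' : A.IsHomLift (𝟙 (A.obj X)) s := by
    have e : A.obj N.X.1 = A.obj X := N.X.2
    change A.IsHomLift (𝟙 (A.obj N.X.1)) s at hs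
    rwa [e] at hs
  let η' : inFiber A X ⟶ N.X := ⟨η, hη⟩
  let x' : N.X ⟶ inFiber A X := ⟨x, hx'⟩
  let s' : N.X ⟶ N'.X := ⟨s, hs'⟩
  have hu : A.IsHomLift (𝟙 (A.obj X)) (Hom.hom u) := by
    have : A.IsHomLift (𝟙 (A.obj X)) (s ≫ Hom.hom u) := hsu ▸ (x' ≫ η').2
    exact isHomLift_of_comp _ s _
  have hv : A.IsHomLift (𝟙 (A.obj X)) (Hom.hom v) := by
    have : A.IsHomLift (𝟙 (A.obj X)) (s ≫ Hom.hom v) := hsv ▸ IsHomLift.id N.X.2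
    exact isHomLift_of_comp _ s _
  let u₀ : N'.X ⟶ N.X := ⟨Hom.hom u, hu⟩
  let v₀ : N'.X ⟶ N.X := ⟨Hom.hom v, hv⟩
  obtain ⟨u₁, u₂⟩ := (exists_hom_iff u₀).1 ⟨u, rfl⟩
  obtain ⟨v₁, v₂⟩ := (exists_hom_iff v₀).1 ⟨v, rfl⟩
  have key := Overcat.existsUnique_monObj_of_split (Mon.Hom.mk' u₀ u₂ u₁ : N' ⟶ N)
    (Mon.Hom.mk' v₀ v₂ v₁) η' x' s' (Subtype.ext hηx) (Subtype.ext hsu) (Subtype.ext hsv)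
    (Subtype.ext hx)
  refine (existsUnique_congr fun m => ?_).1 key
  exact (exists_hom_iff (M := { X := inFiber A X, mon := m }) x').symm

/-- An arrow which becomes a morphism of overmonoids after composition with a split epimorphism
of overmonoids is a morphism of overmonoids. -/
lemma exists_hom_of_split {Q C D : OverMon A} (q : Q ⟶ C) (g : Q ⟶ D)
    (η : C.carrier ⟶ Q.carrier) (hη : A.IsHomLift (𝟙 (A.obj C.carrier)) η)
    (hηq : η ≫ Hom.hom q = 𝟙 C.carrier) (f : C.carrier ⟶ D.carrier)
    (hf : Hom.hom q ≫ f = Hom.hom g) : ∃ f' : C ⟶ D, Hom.hom f' = f := by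
  have hQ : Q.base = C.base := Q.mon.X.2.symm.trans
    ((IsHomLift.codomain_eq A (𝟙 (A.obj C.carrier)) η).trans C.mon.X.2)
  obtain ⟨B, N⟩ := Q
  obtain ⟨B', M⟩ := C
  dsimp only at hQ
  subst hQ
  have hη' : A.IsHomLift (𝟙 B) η := by
    have e : A.obj M.X.1 = B := M.X.2
    change A.IsHomLift (𝟙 (A.obj M.X.1)) η at hη
    rwa [e] at hη
  have hq : A.IsHomLift (𝟙 B) (Hom.hom q) := by
    have : A.IsHomLift (𝟙 B) (η ≫ Hom.hom q) := hηq ▸ IsHomLift.id M.X.2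
    exact isHomLift_of_comp _ η _
  let η' : M.X ⟶ N.X := ⟨η, hη'⟩
  let q' : N.X ⟶ M.X := ⟨Hom.hom q, hq⟩
  have hηq' : η' ≫ q' = 𝟙 M.X := Subtype.ext hηq
  obtain ⟨q₁, q₂⟩ := (exists_hom_iff q').1 ⟨q, rfl⟩
  let g' : Lift (Hom.base g) N.X D.mon.X := Hom.lift g
  obtain ⟨g₁, g₂⟩ : g'.IsMonHom := Hom.isMonHom g
  let F : Lift (Hom.base g) M.X D.mon.X := Lift.pre η' g'
  have hqF : Lift.pre q' F = g' := by
    refine Lift.ext ?_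
    change Hom.hom q ≫ η ≫ Hom.hom g = Hom.hom g
    rw [← hf, reassoc_of% hηq]
  -- The multiplication of the target of `q` is recovered from that of its source through the
  -- splitting.
  have hF : F.IsMonHom := by
    constructor
    · have e : M.mon.mul = (η' ⊗ₘ η') ≫ N.mon.mul ≫ q' := by
        rw [q₁, tensorHom_comp_tensorHom_assoc, hηq', id_tensorHom_id, Category.id_comp]
      rw [e, ← Lift.pre_pre, ← Lift.pre_pre, hqF, g₁, Lift.pre_post, ← Lift.tens_pre]
    · rw [← q₂, ← Lift.pre_pre, hqF, g₂]
  refine ⟨Hom.ofLift (C := ⟨B, M⟩) F hF, ?_⟩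
  change η ≫ Hom.hom g = f
  rw [← hf, reassoc_of% hηq]

end OverMon

end SplitOvermonoid

/-! ### Overmonadicity -/

section Overmonadic

lemma algebra_ext {C : Type u₁} [Category.{v₁} C] {T : Monad C} {Z W : T.Algebra}
    (hA : Z.A = W.A) (ha : HEq Z.a W.a) : Z = W := by
  cases Z
  cases W
  cases hA
  cases ha
  rfl

variable {E : Type u₁} [Category.{v₁} E] {G : Type u₂} [Category.{v₂} G] {A : E ⥤ G}
  [MonoidalOvercategory A]

/-- The inverse equips the object under an algebra with its unique monoid structure;
`exists_hom_of_split` supplies its action on arrows. -/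
theorem comparison_isOverIso {F : E ⥤ OverMon A}
    (h : OverAdjunction A (OverMon.arity A) F (OverMon.forget A)) :
    IsOverIso (OverMon.arity A) (h.adj.toMonad.forget ⋙ A) (Monad.comparison h.adj) := by
  have key (Z : h.adj.toMonad.Algebra) : ∃! m : MonObj (inFiber A Z.A),
      ∃ f : F.obj Z.A ⟶ (⟨A.obj Z.A, { X := inFiber A Z.A, mon := m }⟩ : OverMon A),
        OverMon.Hom.hom f = Z.a :=
    OverMon.existsUnique_monObj_of_split (F.map Z.a) (h.adj.counit.app (F.obj Z.A))
      (h.adj.unit.app Z.A) Z.a (h.adj.unit.app ((OverMon.forget A).obj (F.obj Z.A)))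
      (h.unit_over _) (h.unit_over _) Z.unit (h.adj.unit.naturality Z.a).symm
      (h.adj.right_triangle_components (F.obj Z.A)) Z.assoc.symm
  choose m hm using fun Z => (key Z).exists
  choose ε hε using hm
  let S (Z : h.adj.toMonad.Algebra) : OverMon A :=
    ⟨A.obj Z.A, { X := inFiber A Z.A, mon := m Z }⟩
  have hS {Z W : h.adj.toMonad.Algebra} (φ : Z ⟶ W) :
      ∃ f : S Z ⟶ S W, OverMon.Hom.hom f = φ.f := by
    refine OverMon.exists_hom_of_split (ε Z) (F.map φ.f ≫ ε W) (h.adj.unit.app Z.A)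
      (h.unit_over Z.A) ((congrArg (h.adj.unit.app Z.A ≫ ·) (hε Z)).trans Z.unit) φ.f ?_
    rw [OverMon.comp_hom, hε, hε]
    exact φ.h.symm
  choose S' hS' using @hS
  let L : h.adj.toMonad.Algebra ⥤ OverMon A :=
    { obj := S
      map := S'
      map_id := fun Z => OverMon.hom_ext (hS' (𝟙 Z))
      map_comp := fun φ ψ => OverMon.hom_ext ((hS' (φ ≫ ψ)).trans
        (congrArg₂ (· ≫ ·) (hS' φ) (hS' ψ)).symm) }
  -- Both arrows have the identity of `Z.A` as their adjunct.
  have hcounit (Z : h.adj.toMonad.Algebra) : h.adj.counit.app (S Z) = ε Z := by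
    refine (h.adj.homEquiv _ _).injective ?_
    refine (h.adj.homEquiv_unit _ _ _).trans (Eq.trans ?_ (h.adj.homEquiv_unit _ _ _).symm)
    refine (h.adj.right_triangle_components (S Z)).trans ?_
    exact Z.unit.symm.trans (congrArg (h.adj.unit.app Z.A ≫ ·) (hε Z).symm)
  -- The original structure of `C` also makes the counit a morphism, so uniqueness gives an equality
  -- of overmonoids.
  have hKL (C : OverMon A) : S ((Monad.comparison h.adj).obj C) = C := by
    obtain ⟨B, @⟨⟨X, rfl⟩, mon⟩⟩ := C
    let C : OverMon A := ⟨A.obj X, { X := inFiber A X, mon := mon }⟩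
    have e := (key ((Monad.comparison h.adj).obj C)).unique (y₂ := mon) ⟨ε _, hε _⟩
      ⟨h.adj.counit.app C, rfl⟩
    exact congrArg (fun n : MonObj (inFiber A X) =>
      OverMon.mk (A.obj X) { X := inFiber A X, mon := n }) e
  have hLK (Z : h.adj.toMonad.Algebra) : (Monad.comparison h.adj).obj (S Z) = Z := by
    refine algebra_ext rfl (heq_of_eq ?_)
    exact (congrArg OverMon.Hom.hom (hcounit Z)).trans (hε Z)
  refine ⟨h.right_over, L, ?_, ?_, ?_⟩
  · refine CategoryTheory.Functor.ext (fun _ => rfl) fun Z W φ => ?_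
    refine Eq.trans ?_ ((Category.id_comp _).trans (Category.comp_id (A.map φ.f))).symm
    refine isHomLift_unique (A := A) φ.f ?_ (IsHomLift.map A φ.f)
    have := OverMon.Hom.isHomLift (S' φ)
    rwa [hS'] at this
  · refine CategoryTheory.Functor.ext hKL fun C D f => OverMon.hom_ext ?_
    refine (hS' ((Monad.comparison h.adj).map f)).trans ?_
    have e₁ : OverMon.Hom.hom (eqToHom (hKL C)) = 𝟙 C.carrier :=
      eqToHom_map (OverMon.forget A) (hKL C)
    have e₂ : OverMon.Hom.hom (eqToHom (hKL D).symm) = 𝟙 D.carrier :=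
      eqToHom_map (OverMon.forget A) (hKL D).symm
    change OverMon.Hom.hom f = OverMon.Hom.hom (eqToHom (hKL C)) ≫ OverMon.Hom.hom f ≫
      OverMon.Hom.hom (eqToHom (hKL D).symm)
    rw [e₁, e₂]
    exact ((Category.id_comp _).trans (Category.comp_id _)).symm
  · refine CategoryTheory.Functor.ext hLK fun Z W φ => Monad.Algebra.Hom.ext ?_
    refine (hS' φ).trans ?_
    have e₁ : (eqToHom (hLK Z)).f = 𝟙 Z.A := eqToHom_map h.adj.toMonad.forget (hLK Z)
    have e₂ : (eqToHom (hLK W).symm).f = 𝟙 W.A := eqToHom_map h.adj.toMonad.forget (hLK W).symm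
    change φ.f = (eqToHom (hLK Z)).f ≫ φ.f ≫ (eqToHom (hLK W).symm).f
    rw [e₁, e₂]
    exact ((Category.id_comp _).trans (Category.comp_id _)).symm

end Overmonadic

end Overcat

theorem mainTheorem5 {E : Type u₁} [Category.{v₁} E] {G : Type u₂} [Category.{v₂} G]
    (A : E ⥤ G) [Overcat.MonoidalOvercategory A] (hA : Overcat.IsLiberal A)
    (hB : ∀ B : G, Nonempty (IsInitial (Overcat.unitObj A B)))
    (hb : ∀ (B B' : G) (b : B ⟶ B'), Nonempty (IsInitial (Overcat.unitArrow A b))) :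
    (∃ M : E ⥤ Overcat.OverMon A, Nonempty
      (Overcat.OverAdjunction A (Overcat.OverMon.arity A) M (Overcat.OverMon.forget A))) ∧
    Overcat.IsOvermonadic A (Overcat.OverMon.arity A) (Overcat.OverMon.forget A) :=
  ⟨Overcat.exists_leftOveradjoint hA hB hb, Overcat.exists_leftOveradjoint hA hB hb,
    fun _ h => Overcat.comparison_isOverIso h⟩
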